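/- For integers $k\ge 1$ and $m\in\mathbb{Z}$, Garvan's $k$-rank counts $N_k(m,n)$, $n\ge 0$, are defined by the formal power series identity \[ \sum_{n=0}^{\infty}N_k(m,n)q^n=\frac{1}{(q;q)_\infty}\sum_{n=1}^{\infty}(-1)^{n-1}q^{n((2k-1)n-1)/2+|m|n}(1-q^n), \qquad (q;q)_\infty=\prod_{i=1}^{\infty}(1-q^i). \] **Theorem.** Let $k\ge 3$, $n\ge k-1$ and $m\in\mathbb{Z}$ be integers. Then \[ N_k(m,n+1)\ge N_k(m,n) \] except when $n=|m|+k-1$ or $(k,m,n)=(3,0,8)$; in each of these exceptional cases the inequality fails. -/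

import Mathlib

namespace GarvanRank

noncomputable section

open PowerSeries
open scoped PowerSeries.WithPiTopology

/-- The infinite product `(q; q)_∞ = ∏_{i ≥ 1} (1 - q ^ i)` as a formal power series over `ℤ`
(the limit is coefficientwise, with `ℤ` discrete). -/
def eulerProduct : PowerSeries ℤ :=
  ∏' i : ℕ, (1 - X ^ (i + 1))

/-- The `n`-th term `(-1) ^ (n - 1) q ^ (n ((2 k - 1) n - 1) / 2 + |m| n) (1 - q ^ n)` of the series
in the generating function; it is used for `k, n ≥ 1`, where the subtractions do not truncate
and the division by `2` is exact. -/
def rankTerm (k : ℕ) (m : ℤ) (n : ℕ) : PowerSeries ℤ :=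
  (-1) ^ (n - 1) * X ^ (n * ((2 * k - 1) * n - 1) / 2 + m.natAbs * n) * (1 - X ^ n)

/-- The series `∑_{n ≥ 1} (-1) ^ (n - 1) q ^ (n ((2 k - 1) n - 1) / 2 + |m| n) (1 - q ^ n)`. -/
def rankSeries (k : ℕ) (m : ℤ) : PowerSeries ℤ :=
  ∑' i : ℕ, rankTerm k m (i + 1)

/-- The generating function
`∑_{n ≥ 0} N_k(m, n) q ^ n =
  1 / (q; q)_∞ * ∑_{n ≥ 1} (-1) ^ (n - 1) q ^ (n ((2 k - 1) n - 1) / 2 + |m| n) (1 - q ^ n)`. -/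
def rankGenFun (k : ℕ) (m : ℤ) : PowerSeries ℤ :=
  invOfUnit eulerProduct 1 * rankSeries k m

/-- Garvan's `k`-rank count `N_k(m, n)`, for `k ≥ 1`: the coefficient of `q ^ n` in the
generating function. -/
def N (k : ℕ) (m : ℤ) (n : ℕ) : ℤ :=
  coeff n (rankGenFun k m)

/-- The infinite product converges. -/
theorem multipliable_eulerProduct :
    Multipliable fun i : ℕ => (1 - X ^ (i + 1) : PowerSeries ℤ) :=
  WithPiTopology.multipliable_one_sub_X_pow ℤ

theorem constantCoeff_eulerProduct : constantCoeff eulerProduct = 1 := by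
  have h := multipliable_eulerProduct.map_tprod (constantCoeff (R := ℤ))
    (WithPiTopology.continuous_constantCoeff ℤ)
  rw [eulerProduct, h]
  simp

/-- `invOfUnit eulerProduct 1` is indeed the inverse of `(q; q)_∞`. -/
theorem eulerProduct_mul_inv : eulerProduct * invOfUnit eulerProduct 1 = 1 :=
  mul_invOfUnit _ _ (by simp [constantCoeff_eulerProduct])

/-- For `k ≥ 2` the series converges. -/
theorem summable_rankTerm (k : ℕ) (hk : 2 ≤ k) (m : ℤ) :
    Summable fun i : ℕ => rankTerm k m (i + 1) := by
  rw [WithPiTopology.summable_iff_summable_coeff]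
  intro d
  apply summable_of_hasFiniteSupport
  refine (Set.finite_le_nat d).subset fun i hi => ?_
  by_contra hd
  simp only [Set.mem_ofPred_eq, not_le] at hd
  apply hi
  have hexp : d < (i + 1) * ((2 * k - 1) * (i + 1) - 1) / 2 + m.natAbs * (i + 1) := by
    have h1 : 3 * (i + 1) ≤ (2 * k - 1) * (i + 1) := Nat.mul_le_mul_right _ (by omega)
    have h2 : (i + 1) * 2 ≤ (i + 1) * ((2 * k - 1) * (i + 1) - 1) :=
      Nat.mul_le_mul_left _ (by omega)
    omega
  have hdvd : (X : PowerSeries ℤ) ^ ((i + 1) * ((2 * k - 1) * (i + 1) - 1) / 2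
      + m.natAbs * (i + 1)) ∣ rankTerm k m (i + 1) :=
    Dvd.intro_left _ rfl |>.mul_right _
  exact X_pow_dvd_iff.1 hdvd d hexp

end

end GarvanRank

/-! Write q for `X` and K + 3 for the k of the theorem. Bailey's lemma (`bailey_succ`) turns the
alternating series into a positive sum over chains of Durfee squares: the generating function is Σ_i
q^(i²) `bailey (K+1) i |m|` (`X_pow_dvd_rankGenFun_sub`).

Multiply by 1 - q. A chain with a strict drop d carries 1/(q;q)_d, which absorbs 1 - q
(`offDiag_nonneg`). The constant chain at i leaves q^((K+2)i²) (1 - q) `bailey 0 i |m|`. For i ≥ 2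
this is nonnegative, except for at most a single -q in the last two factors when m = 0
(`almostNonneg_bailey`). For i = 1 it is q^(K+2+|m|)/(1+q), whose negative terms, apart from
-q^(K+3+|m|), cancel against the chain 2, 1, 1, ....

For m = 0 the defects at exponents (K+2)i² + 1 are paid for by chains starting 3, 2, or once by the
i = 1 term, unless K = 0 and i = 2 (`one_le_coeff_compensation`). The two uncompensated terms are
the exceptions; their coefficients are computed directly to be -1. -/

namespace GarvanRank

noncomputable section

open PowerSeries
open scoped PowerSeries.WithPiTopology

/-! ### Coefficientwise nonnegativity -/

/-- A power series over `ℤ` all of whose coefficients are nonnegative. -/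
def NonnegCoeff (f : PowerSeries ℤ) : Prop := ∀ n, 0 ≤ coeff n f

namespace NonnegCoeff

variable {f g : PowerSeries ℤ}

theorem zero : NonnegCoeff 0 := fun n => by simp

theorem one : NonnegCoeff 1 := fun n => by
  rw [coeff_one]; split_ifs <;> simp

theorem X_pow (a : ℕ) : NonnegCoeff (X ^ a) := fun n => by
  rw [coeff_X_pow]; split_ifs <;> simp

theorem add (hf : NonnegCoeff f) (hg : NonnegCoeff g) : NonnegCoeff (f + g) := fun n => by
  rw [map_add]; exact add_nonneg (hf n) (hg n)

theorem mul (hf : NonnegCoeff f) (hg : NonnegCoeff g) : NonnegCoeff (f * g) := fun n => by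
  rw [coeff_mul]; exact Finset.sum_nonneg fun p _ => mul_nonneg (hf _) (hg _)

theorem sum {ι : Type*} {s : Finset ι} {f : ι → PowerSeries ℤ}
    (h : ∀ i ∈ s, NonnegCoeff (f i)) : NonnegCoeff (∑ i ∈ s, f i) := fun n => by
  rw [map_sum]; exact Finset.sum_nonneg fun i hi => h i hi n

theorem prod {ι : Type*} {s : Finset ι} {f : ι → PowerSeries ℤ}
    (h : ∀ i ∈ s, NonnegCoeff (f i)) : NonnegCoeff (∏ i ∈ s, f i) := by
  classical
  induction s using Finset.induction_on with
  | empty => simpa using one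
  | insert a s ha ih =>
    rw [Finset.prod_insert ha]
    exact (h a (by simp)).mul (ih fun i hi => h i (by simp [hi]))

/-- Subtracting a monomial from a series whose corresponding coefficient is positive. -/
theorem sub_X_pow (hf : NonnegCoeff f) {a : ℕ} (ha : 1 ≤ coeff a f) :
    NonnegCoeff (f - X ^ a) := fun n => by
  rw [map_sub, coeff_X_pow]
  split_ifs with h
  · subst h; omega
  · simpa using hf n

/-- Unrolling gives F m = Σ_r q^(ar) H (m + r), which converges because a > 0; strong induction on
the coefficient index replaces the limit. -/
theorem of_forall_succ {F H : ℕ → PowerSeries ℤ} {a : ℕ} (ha : 0 < a)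
    (hF : ∀ m, F m = H m + X ^ a * F (m + 1)) (hH : ∀ m, NonnegCoeff (H m)) (m : ℕ) :
    NonnegCoeff (F m) := by
  intro n
  induction n using Nat.strong_induction_on generalizing m with
  | _ n ih =>
    rw [hF, map_add, coeff_X_pow_mul']
    have := hH m n
    split_ifs with h
    · have := ih (n - a) (by omega) (m + 1)
      omega
    · omega

end NonnegCoeff

/-! ### Finite q-products and their inverses -/

/-- The geometric series `1 / (1 - q ^ a)`, for `a ≥ 1`. -/
def geo (a : ℕ) : PowerSeries ℤ := PowerSeries.mk fun n => if a ∣ n then 1 else 0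

theorem coeff_geo (a n : ℕ) : coeff n (geo a) = if a ∣ n then 1 else 0 := coeff_mk _ _

theorem geo_nonneg (a : ℕ) : NonnegCoeff (geo a) := fun n => by
  rw [coeff_geo]; split_ifs <;> simp

theorem one_sub_mul_geo {a : ℕ} (ha : 0 < a) : (1 - X ^ a) * geo a = 1 := by
  ext n
  rw [sub_mul, one_mul, map_sub, coeff_X_pow_mul', coeff_geo, coeff_geo, coeff_one]
  rcases Nat.eq_zero_or_pos n with rfl | hn
  · simp [ha.ne']
  · by_cases h : a ≤ n
    · have hd : a ∣ n - a ↔ a ∣ n := Nat.dvd_sub_iff_left h dvd_rfl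
      simp [h, hn.ne', hd]
    · have : ¬ a ∣ n := fun hd => h (Nat.le_of_dvd hn hd)
      simp [h, hn.ne', this]

theorem geo_eq {a : ℕ} (ha : 0 < a) : geo a = 1 + X ^ a * geo a := by
  linear_combination one_sub_mul_geo ha

/-- The finite product `(q; q)_n`. -/
def qPoch (n : ℕ) : PowerSeries ℤ := ∏ i ∈ Finset.range n, (1 - X ^ (i + 1))

/-- The inverse `1 / (q; q)_n`. -/
def qInv (n : ℕ) : PowerSeries ℤ := ∏ i ∈ Finset.range n, geo (i + 1)

theorem qPoch_mul_qInv (n : ℕ) : qPoch n * qInv n = 1 := by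
  rw [qPoch, qInv, ← Finset.prod_mul_distrib]
  exact Finset.prod_eq_one fun i _ => one_sub_mul_geo i.succ_pos

theorem qInv_zero : qInv 0 = 1 := by simp [qInv]

theorem qInv_succ (n : ℕ) : qInv (n + 1) = qInv n * geo (n + 1) := Finset.prod_range_succ _ _

theorem one_sub_mul_qInv (n : ℕ) : (1 - X ^ (n + 1)) * qInv (n + 1) = qInv n := by
  rw [qInv_succ]
  linear_combination qInv n * one_sub_mul_geo (Nat.add_pos_right n one_pos)

theorem qInv_nonneg (n : ℕ) : NonnegCoeff (qInv n) := .prod fun _ _ => geo_nonneg _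

theorem one_sub_X_mul_qInv_nonneg (n : ℕ) : NonnegCoeff ((1 - X) * qInv (n + 1)) := by
  have h := one_sub_mul_geo one_pos
  rw [pow_one] at h
  rw [qInv, Finset.prod_range_succ', mul_left_comm, zero_add, h, mul_one]
  exact .prod fun _ _ => geo_nonneg _

/-- A limiting case of the `q`-Chu–Vandermonde summation. -/
theorem sum_qInv_mul (N a : ℕ) :
    ∑ s ∈ Finset.range (N + 1), X ^ (s ^ 2 + a * s) * qInv (N - s) * qInv s * qInv (s + a) =
      qInv N * qInv (N + a) := by
  induction N generalizing a with
  | zero => simp [qInv_zero]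
  | succ N ih =>
    suffices h : (1 - X ^ (N + 1)) * ∑ s ∈ Finset.range (N + 1 + 1),
        X ^ (s ^ 2 + a * s) * qInv (N + 1 - s) * qInv s * qInv (s + a) =
          qInv N * qInv (N + 1 + a) by
      rw [qInv_succ N]
      linear_combination geo (N + 1) * h - (∑ s ∈ Finset.range (N + 1 + 1),
        X ^ (s ^ 2 + a * s) * qInv (N + 1 - s) * qInv s * qInv (s + a)) *
          one_sub_mul_geo (Nat.add_pos_right N one_pos)
    -- Splits 1 - q^(N+1) as (1 - q^s) + q^s (1 - q^(N+1-s)). After shifting s in the first part,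
    -- the two recombine into the sum for N with a + 1.
    have key : ∀ s ∈ Finset.range (N + 1 + 1), (1 - X ^ (N + 1)) *
        (X ^ (s ^ 2 + a * s) * qInv (N + 1 - s) * qInv s * qInv (s + a)) =
        (1 - X ^ s) * (X ^ (s ^ 2 + a * s) * qInv (N + 1 - s) * qInv s * qInv (s + a)) +
        (1 - X ^ (N + 1 - s)) *
          (X ^ (s ^ 2 + (a + 1) * s) * qInv (N + 1 - s) * qInv s * qInv (s + a)) := by
      intro s hs
      obtain ⟨d, hd⟩ := Nat.exists_eq_add_of_le (Nat.lt_succ_iff.1 (Finset.mem_range.1 hs))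
      rw [hd, Nat.add_sub_cancel_left]
      ring
    rw [Finset.mul_sum, Finset.sum_congr rfl key, Finset.sum_add_distrib, Finset.sum_range_succ',
      Finset.sum_range_succ _ (N + 1)]
    simp only [pow_zero, sub_self, zero_mul, add_zero, Nat.sub_self]
    have hih := ih (a + 1)
    rw [← Finset.sum_add_distrib]
    rw [show N + 1 + a = N + (a + 1) by ring, ← hih]
    refine Finset.sum_congr rfl fun s hs => ?_
    obtain ⟨d, rfl⟩ := Nat.exists_eq_add_of_le (Nat.lt_succ_iff.1 (Finset.mem_range.1 hs))
    rw [show s + d + 1 - (s + 1) = d by omega, show s + d + 1 - s = d + 1 by omega,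
      show s + d - s = d by omega, show s + 1 + a = s + a + 1 by ring,
      show s + (a + 1) = s + a + 1 by ring, ← one_sub_mul_qInv s, ← one_sub_mul_qInv (s + a),
      ← one_sub_mul_qInv d]
    ring

/-! ### The Bailey pair and its recurrences -/

/-- The summand of the Bailey pair, iterated `j` times. -/
def baileyTerm (j m t : ℕ) : PowerSeries ℤ :=
  (-1) ^ t * X ^ (j * (t + 1) ^ 2 + (t + 1).choose 2 + m * (t + 1)) * (1 - X ^ (t + 1))

/-- The `β`-side of the `j`-th iterate of the Bailey pair that belongs to the coefficient of `z ^ m`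
in `1 / ((z q; q)_n (q / z; q)_n)`. -/
def bailey (j n m : ℕ) : PowerSeries ℤ :=
  ∑ t ∈ Finset.range n, baileyTerm j m t * qInv (n - (t + 1)) * qInv (n + (t + 1))

/-- The empty sum is 0 even at m = 0, where the coefficient in the empty product would be 1. Hence
the recurrence at m = 0 needs n ≥ 1. -/
theorem bailey_zero (j m : ℕ) : bailey j 0 m = 0 := by simp [bailey]

/-- Bailey's lemma. With i = t + 1 + s one has i² = (t+1)² + s² + 2(t+1)s, so after exchanging sums
the inner one is `sum_qInv_mul` with a = 2(t+1). -/
theorem bailey_succ (j n m : ℕ) :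
    bailey (j + 1) n m =
      ∑ i ∈ Finset.range (n + 1), X ^ (i ^ 2) * qInv (n - i) * bailey j i m := by
  have h1 : ∀ t ∈ Finset.range n, baileyTerm (j + 1) m t * qInv (n - (t + 1)) * qInv (n + (t + 1))
      = ∑ i ∈ Finset.Ico (t + 1) (n + 1), X ^ (i ^ 2) * qInv (n - i) *
        (baileyTerm j m t * qInv (i - (t + 1)) * qInv (i + (t + 1))) := by
    intro t ht
    obtain ⟨N, rfl⟩ := Nat.exists_eq_add_of_le (Nat.succ_le_of_lt (Finset.mem_range.1 ht))
    have h := sum_qInv_mul N (2 * (t + 1))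
    rw [Finset.sum_Ico_eq_sum_range, show t.succ + N + 1 - (t + 1) = N + 1 by omega]
    rw [show t.succ + N - (t + 1) = N by omega,
      show t.succ + N + (t + 1) = N + 2 * (t + 1) by omega, mul_assoc, ← h, Finset.mul_sum]
    refine Finset.sum_congr rfl fun s hs => ?_
    rw [show t.succ + N - (t + 1 + s) = N - s by omega, show t + 1 + s - (t + 1) = s by omega,
      show t + 1 + s + (t + 1) = s + 2 * (t + 1) by omega, baileyTerm, baileyTerm]
    ring
  rw [bailey, Finset.sum_congr rfl h1]
  simp only [bailey, Finset.mul_sum]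
  refine Finset.sum_comm' fun x y => ?_
  simp only [Finset.mem_range, Finset.mem_Ico]
  omega

theorem bailey_one (j m : ℕ) : bailey j 1 m = X ^ (j + m) * geo 2 := by
  simp [bailey, baileyTerm, qInv, Finset.prod_range_succ]
  have h := one_sub_mul_geo one_pos
  rw [pow_one] at h
  linear_combination X ^ (j + m) * geo 2 * h

/-- Termwise with r = t + 1: 1 + q^(2n+2) - q^(n+1)(q^r + q^(-r)) = (1 - q^(n+1-r))(1 - q^(n+1+r)),
which strips the last factor from each q-product. -/
theorem bailey_recurrence_succ (n m : ℕ) :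
    bailey 0 n (m + 1) = (1 + X ^ (2 * (n + 1))) * bailey 0 (n + 1) (m + 1) -
      X ^ (n + 1) * (bailey 0 (n + 1) m + bailey 0 (n + 1) (m + 2)) := by
  have h : ∀ t d : ℕ, t + d = n → (1 + X ^ (2 * (n + 1))) * (baileyTerm 0 (m + 1) t *
      qInv (n + 1 - (t + 1)) * qInv (n + 1 + (t + 1))) - X ^ (n + 1) *
      (baileyTerm 0 m t * qInv (n + 1 - (t + 1)) * qInv (n + 1 + (t + 1)) +
        baileyTerm 0 (m + 2) t * qInv (n + 1 - (t + 1)) * qInv (n + 1 + (t + 1))) =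
      baileyTerm 0 (m + 1) t * ((1 - X ^ d) * qInv d) * qInv (n + (t + 1)) := by
    rintro t d rfl
    rw [show t + d + 1 - (t + 1) = d by omega, show t + d + 1 + (t + 1) = t + d + (t + 1) + 1 by ring,
      ← one_sub_mul_qInv (t + d + (t + 1)), baileyTerm, baileyTerm, baileyTerm]
    ring
  simp only [bailey]
  rw [← Finset.sum_add_distrib, Finset.mul_sum, Finset.mul_sum, ← Finset.sum_sub_distrib,
    Finset.sum_range_succ, h n 0 (by simp)]
  simp only [pow_zero, sub_self, zero_mul, mul_zero, add_zero]
  refine Finset.sum_congr rfl fun t ht => ?_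
  obtain ⟨d, rfl⟩ := Nat.exists_eq_add_of_lt (Finset.mem_range.1 ht)
  rw [h t (d + 1) (by ring), one_sub_mul_qInv, show t + d + 1 - (t + 1) = d by omega]

/-- At m = 0 the index -1 is replaced by 1; this sum is the resulting discrepancy. Times 1 - q^n,
its partial sums have a closed form that cancels the last term. -/
theorem sum_telescope_eq_zero {n : ℕ} (hn : 0 < n) :
    ∑ t ∈ Finset.range (n + 1), baileyTerm 0 0 t * (X ^ (n - t) - X ^ (n + t + 2)) *
      qInv (n - t) * qInv (n + t + 2) = 0 := by
  have h : ∀ N d, N + d = n → (1 - X ^ n) * ∑ t ∈ Finset.range N, baileyTerm 0 0 t *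
      (X ^ (n - t) - X ^ (n + t + 2)) * qInv (n - t) * qInv (n + t + 2) =
      - (baileyTerm 0 0 N * X ^ d * (1 - X ^ N) * qInv d * qInv (n + N + 1)) := by
    intro N
    induction N with
    | zero => intro d hd; simp
    | succ N ih =>
      intro d hd
      rw [Finset.sum_range_succ, mul_add, ih (d + 1) (by omega)]
      subst hd
      rw [show N + 1 + d - N = d + 1 by omega, ← one_sub_mul_qInv d,
        ← one_sub_mul_qInv (N + 1 + d + N + 1), show N + 1 + d + (N + 1) + 1 = N + 1 + d + N + 1 + 1 by ring,
        show N + 1 + d + N + 2 = N + 1 + d + N + 1 + 1 by ring]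
      simp only [baileyTerm]
      rw [Nat.choose_succ_succ' (N + 1) 1, Nat.choose_one_right]
      ring
  have h2 := h n 0 (by simp)
  have h3 := one_sub_mul_geo hn
  have : (1 - X ^ n) * ∑ t ∈ Finset.range (n + 1), baileyTerm 0 0 t *
      (X ^ (n - t) - X ^ (n + t + 2)) * qInv (n - t) * qInv (n + t + 2) = 0 := by
    rw [Finset.sum_range_succ, mul_add, h2, show n + n + 2 = n + n + 1 + 1 by ring,
      ← one_sub_mul_qInv (n + n + 1), Nat.sub_self]
    ring
  exact (mul_eq_zero.1 this).resolve_left (left_ne_zero_of_mul_eq_one h3)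

theorem bailey_recurrence_zero {n : ℕ} (hn : 0 < n) :
    bailey 0 n 0 = (1 + X ^ (2 * (n + 1))) * bailey 0 (n + 1) 0 -
      X ^ (n + 1) * (2 * bailey 0 (n + 1) 1) := by
  have h : ∀ t d : ℕ, t + d = n → (1 + X ^ (2 * (n + 1))) * (baileyTerm 0 0 t *
      qInv (n + 1 - (t + 1)) * qInv (n + 1 + (t + 1))) - X ^ (n + 1) * (2 *
      (baileyTerm 0 1 t * qInv (n + 1 - (t + 1)) * qInv (n + 1 + (t + 1)))) -
      baileyTerm 0 0 t * (X ^ (n - t) - X ^ (n + t + 2)) * qInv (n - t) * qInv (n + t + 2) =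
      baileyTerm 0 0 t * ((1 - X ^ d) * qInv d) * qInv (n + (t + 1)) := by
    rintro t d rfl
    rw [show t + d + 1 - (t + 1) = d by omega, show t + d + 1 + (t + 1) = t + d + (t + 1) + 1 by ring,
      show t + d - t = d by omega, show t + d + t + 2 = t + d + (t + 1) + 1 by ring,
      ← one_sub_mul_qInv (t + d + (t + 1)), baileyTerm, baileyTerm]
    ring
  rw [← sub_zero (_ - _ : PowerSeries ℤ), ← sum_telescope_eq_zero hn]
  simp only [bailey]
  rw [Finset.mul_sum, Finset.mul_sum, Finset.mul_sum, ← Finset.sum_sub_distrib,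
    ← Finset.sum_sub_distrib, Finset.sum_range_succ _ n, h n 0 (by simp)]
  simp only [pow_zero, sub_self, zero_mul, mul_zero, add_zero]
  refine Finset.sum_congr rfl fun t ht => ?_
  obtain ⟨d, rfl⟩ := Nat.exists_eq_add_of_lt (Finset.mem_range.1 ht)
  rw [h t (d + 1) (by ring), one_sub_mul_qInv, show t + d + 1 - (t + 1) = d by omega]

/-! ### Positivity from the symmetric recurrence -/

/-- The two-variable recurrence satisfied by the Bailey pair in `m`, where `i` is the new index:
multiplication by `(1 - z q ^ i) (1 - q ^ i / z)` of series symmetric in `z ↔ 1 / z`. -/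
structure SymmRecurrence (i : ℕ) (B A : ℕ → PowerSeries ℤ) : Prop where
  zero : B 0 = (1 + X ^ (2 * i)) * A 0 - X ^ i * (2 * A 1)
  succ : ∀ m, B (m + 1) = (1 + X ^ (2 * i)) * A (m + 1) - X ^ i * (A m + A (m + 2))

namespace SymmRecurrence

variable {i : ℕ} {A B : ℕ → PowerSeries ℤ}

theorem upper (h : SymmRecurrence i B A) (m : ℕ) :
    A (m + 1) - X ^ i * A m = B (m + 1) + X ^ i * (A (m + 2) - X ^ i * A (m + 1)) := by
  linear_combination -h.succ m

theorem lower_zero (h : SymmRecurrence i B A) :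
    A 0 - X ^ i * A 1 = B 0 + X ^ i * (A 1 - X ^ i * A 0) := by
  linear_combination -h.zero

theorem lower_succ (h : SymmRecurrence i B A) (m : ℕ) :
    A (m + 1) - X ^ i * A (m + 2) = B (m + 1) + X ^ i * (A m - X ^ i * A (m + 1)) := by
  linear_combination -h.succ m

theorem upper_nonneg (h : SymmRecurrence i B A) (hi : 0 < i)
    (hB : ∀ m, NonnegCoeff (B (m + 1))) (m : ℕ) : NonnegCoeff (A (m + 1) - X ^ i * A m) :=
  .of_forall_succ (F := fun m => A (m + 1) - X ^ i * A m) hi h.upper hB m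

/-- A m - q^i A (m+1) - B m is q^i times the upper difference A 1 - q^i A 0 if m = 0, and q^i times
the preceding lower difference otherwise. -/
theorem sub_nonneg (h : SymmRecurrence i B A) (hi : 0 < i) (hB : ∀ m, NonnegCoeff (B m)) (m : ℕ) :
    NonnegCoeff (A m - B m) := by
  have hU := h.upper_nonneg hi fun m => hB (m + 1)
  have hL : ∀ m, NonnegCoeff (A m - X ^ i * A (m + 1) - B m) := by
    intro m
    induction m with
    | zero =>
      rw [h.lower_zero, add_sub_cancel_left]
      exact (NonnegCoeff.X_pow i).mul (hU 0)
    | succ m ih =>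
      rw [h.lower_succ, add_sub_cancel_left]
      refine (NonnegCoeff.X_pow i).mul ?_
      simpa using ih.add (hB m)
  have hA : ∀ m, NonnegCoeff (A m) := fun m =>
    .of_forall_succ (H := fun m => A m - X ^ i * A (m + 1)) hi (fun m => by ring)
      (fun m => by simpa using (hL m).add (hB m)) m
  have := (hL m).add ((NonnegCoeff.X_pow i).mul (hA (m + 1)))
  convert this using 1
  ring

end SymmRecurrence

theorem symmRecurrence_bailey {n : ℕ} (hn : 0 < n) :
    SymmRecurrence (n + 1) (bailey 0 n) (bailey 0 (n + 1)) :=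
  ⟨bailey_recurrence_zero hn, bailey_recurrence_succ n⟩

theorem bailey_base_nonneg (n m : ℕ) : NonnegCoeff (bailey 0 n m) := by
  induction n generalizing m with
  | zero => rw [bailey_zero]; exact .zero
  | succ n ih =>
    rcases Nat.eq_zero_or_pos n with rfl | hn
    · rw [bailey_one]; exact (NonnegCoeff.X_pow _).mul (geo_nonneg _)
    · simpa using ((symmRecurrence_bailey hn).sub_nonneg n.add_one_pos ih m).add (ih m)

theorem bailey_nonneg (j n m : ℕ) : NonnegCoeff (bailey j n m) := by
  induction j generalizing n with
  | zero => exact bailey_base_nonneg n m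
  | succ j ih =>
    rw [bailey_succ]
    exact .sum fun i _ => ((NonnegCoeff.X_pow _).mul (qInv_nonneg _)).mul (ih i)

/-! ### Positivity after multiplication by 1 - q -/

/-- The property of `A m = (1 - q) [z ^ m] 1 / ((z q; q)_i (q / z; q)_i)` that is propagated from
`i` to `i + 1`, for `i ≥ 2`. -/
structure AlmostNonneg (i : ℕ) (A : ℕ → PowerSeries ℤ) : Prop where
  succ : ∀ m, NonnegCoeff (A (m + 1))
  zero : NonnegCoeff (A 0 + X)
  coeff_zero : 1 ≤ coeff 2 (A 0)
  coeff_one : 1 ≤ coeff (i + 2) (A 1)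

/-- The defect -q of A 0 enters A 1 as -q^(i+2), which `coeff_one` for B pays for. That condition
renews itself: coefficient i + 3 of A 1 receives coefficient 2 of A 0, which is unchanged since i +
1 > 2. -/
theorem AlmostNonneg.step {i : ℕ} {A B : ℕ → PowerSeries ℤ} (hi : 2 ≤ i)
    (h : SymmRecurrence (i + 1) B A) (hB : AlmostNonneg i B) : AlmostNonneg (i + 1) A := by
  have hU := h.upper_nonneg i.add_one_pos hB.succ
  have hX := NonnegCoeff.X_pow (i + 1)
  have hL0 : NonnegCoeff (A 0 - X ^ (i + 1) * A 1 + X) := by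
    have := hB.zero.add (hX.mul (hU 0))
    convert this using 1
    rw [h.lower_zero]; ring
  have hL1 : NonnegCoeff (A 1 - X ^ (i + 1) * A 2) := by
    have := ((hB.succ 0).sub_X_pow hB.coeff_one).add (hX.mul hL0)
    convert this using 1
    rw [h.lower_succ 0]; ring
  have hL : ∀ m, NonnegCoeff (A (m + 1) - X ^ (i + 1) * A (m + 2)) := by
    intro m
    induction m with
    | zero => exact hL1
    | succ m ih =>
      rw [h.lower_succ]
      exact (hB.succ _).add (hX.mul ih)
  have hA : ∀ m, NonnegCoeff (A (m + 1)) := fun m =>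
    .of_forall_succ (F := fun m => A (m + 1)) (H := fun m => A (m + 1) - X ^ (i + 1) * A (m + 2))
      i.add_one_pos (fun m => by ring) hL m
  have hc : coeff 2 (A 0) = coeff 2 (B 0) := by
    have := congrArg (coeff 2) h.lower_zero
    simpa [coeff_X_pow_mul', show ¬ i + 1 ≤ 2 by omega] using this
  refine ⟨hA, ?_, hc ▸ hB.coeff_zero, ?_⟩
  · have := hL0.add (hX.mul (hA 0))
    convert this using 1
    ring
  · have h1 : coeff (i + 1 + 2) (A 1) = coeff (i + 1 + 2) (B 1) +
        coeff 2 (A 0 - X ^ (i + 1) * A 1) + coeff 2 (A 2) := by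
      have h2 : A 1 = B 1 + X ^ (i + 1) * (A 0 - X ^ (i + 1) * A 1) + X ^ (i + 1) * A 2 := by
        linear_combination h.lower_succ 0
      conv_lhs => rw [h2]
      rw [map_add, map_add, add_comm (i + 1) 2, coeff_X_pow_mul, coeff_X_pow_mul]
    have h3 : coeff 2 (A 0 - X ^ (i + 1) * A 1) = coeff 2 (A 0) := by
      simp [coeff_X_pow_mul', show ¬ i + 1 ≤ 2 by omega]
    have := hB.coeff_zero
    have := hB.succ 0 (i + 1 + 2)
    have : 0 ≤ coeff 2 (A 2) := hA 1 2
    simp only [zero_add] at *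
    omega

theorem geo_two_sub_nonneg (t : ℕ) : NonnegCoeff (geo 2 - X ^ (2 * t) * geo 4) := fun n => by
  rw [map_sub, coeff_X_pow_mul', coeff_geo, coeff_geo]
  split_ifs <;> omega

theorem one_sub_X_mul_bailey_two (m : ℕ) : (1 - X) * bailey 0 2 m =
    X ^ m * geo 2 * geo 3 - X ^ (2 * m + 1) * geo 3 * geo 4 := by
  simp [bailey, baileyTerm, qInv, Finset.prod_range_succ, Finset.sum_range_succ]
  have h1 := one_sub_mul_geo one_pos
  have h2 := one_sub_mul_geo two_pos
  rw [pow_one] at h1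
  linear_combination (X ^ m * geo 2 * geo 3 * (1 + (1 - X) * geo 1) - X ^ (2 * m + 1) * geo 3 * geo 4
      * ((1 - X ^ 2) * geo 2)) * h1 - X ^ (2 * m + 1) * geo 3 * geo 4 * h2

theorem almostNonneg_two : AlmostNonneg 2 fun m => (1 - X) * bailey 0 2 m := by
  have h2 := geo_eq two_pos
  have h3 := geo_eq three_pos
  have h4 := geo_eq four_pos
  refine ⟨fun m => ?_, ?_, ?_, ?_⟩
  · rw [one_sub_X_mul_bailey_two]
    rcases Nat.even_or_odd' m with ⟨t, rfl | rfl⟩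
    · have := ((NonnegCoeff.X_pow (2 * t + 1)).mul (geo_nonneg 3)).mul
        (geo_two_sub_nonneg (t + 1))
      convert this using 1
      ring
    -- Here the exponents of the two terms differ by an odd number; expanding `geo 3` as 1 + q³ `geo
    -- 3` makes the shift even.
    · have := (NonnegCoeff.X_pow (2 * t + 2)).mul ((geo_nonneg 2).add
        (((NonnegCoeff.X_pow 3).mul (geo_nonneg 3)).mul (geo_two_sub_nonneg t)))
      convert this using 1
      linear_combination X ^ (2 * t + 2) * geo 2 * h3
  · rw [one_sub_X_mul_bailey_two]
    have h : NonnegCoeff (geo 4 - X ^ 4) := (geo_nonneg 4).sub_X_pow (by simp [coeff_geo])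
    have := ((geo_nonneg 3).mul h).add ((NonnegCoeff.X_pow 2).mul (geo_nonneg 4))
    convert this using 1
    have h24 : geo 2 = (1 + X ^ 2) * geo 4 := by
      linear_combination (-(geo 2) * one_sub_mul_geo four_pos +
        (1 + X ^ 2) * geo 4 * one_sub_mul_geo two_pos)
    rw [h24]
    linear_combination (-X) * h3 - X * geo 3 * h4 + X ^ 2 * geo 4 * h3
  · rw [one_sub_X_mul_bailey_two]
    simp [coeff_mul, Finset.Nat.antidiagonal_succ, coeff_geo, coeff_X]
  · rw [one_sub_X_mul_bailey_two]
    simp [coeff_mul, Finset.Nat.antidiagonal_succ, coeff_geo, coeff_X, coeff_X_pow]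

theorem almostNonneg_bailey {i : ℕ} (hi : 2 ≤ i) :
    AlmostNonneg i fun m => (1 - X) * bailey 0 i m := by
  induction i, hi using Nat.le_induction with
  | base => exact almostNonneg_two
  | succ i hi ih =>
    have h := symmRecurrence_bailey (n := i) (by omega)
    refine ih.step hi ⟨?_, fun m => ?_⟩
    · simp only [h.zero]; ring
    · simp only [h.succ]; ring

/-! ### Nonconstant chains -/

/-- The part of `(1 - q) * bailey j n m` that comes from nonconstant chains. -/
def offDiag (j n m : ℕ) : PowerSeries ℤ :=
  (1 - X) * bailey j n m - X ^ (j * n ^ 2) * ((1 - X) * bailey 0 n m)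

theorem offDiag_succ (j n m : ℕ) : offDiag (j + 1) n m = X ^ (n ^ 2) * offDiag j n m +
    ∑ i ∈ Finset.range n, X ^ (i ^ 2) * ((1 - X) * qInv (n - i)) * bailey j i m := by
  have : ∑ i ∈ Finset.range n, X ^ (i ^ 2) * ((1 - X) * qInv (n - i)) * bailey j i m =
      (1 - X) * ∑ i ∈ Finset.range n, X ^ (i ^ 2) * qInv (n - i) * bailey j i m := by
    rw [Finset.mul_sum]; exact Finset.sum_congr rfl fun i _ => by ring
  rw [this, offDiag, offDiag, bailey_succ, Finset.sum_range_succ, Nat.sub_self, qInv_zero]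
  ring

theorem one_sub_X_mul_qInv_mul_nonneg (j m : ℕ) {i n : ℕ} (h : i < n) :
    NonnegCoeff (X ^ (i ^ 2) * ((1 - X) * qInv (n - i)) * bailey j i m) := by
  obtain ⟨d, rfl⟩ := Nat.exists_eq_add_of_lt h
  rw [show i + d + 1 - i = d + 1 by omega]
  exact ((NonnegCoeff.X_pow _).mul (one_sub_X_mul_qInv_nonneg d)).mul (bailey_nonneg _ _ _)

theorem offDiag_nonneg (j n m : ℕ) : NonnegCoeff (offDiag j n m) := by
  induction j with
  | zero => simpa [offDiag] using NonnegCoeff.zero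
  | succ j ih =>
    rw [offDiag_succ]
    exact ((NonnegCoeff.X_pow _).mul ih).add
      (.sum fun i hi => one_sub_X_mul_qInv_mul_nonneg j m (Finset.mem_range.1 hi))

/-- Isolates the chains that drop from n + 1 to n at once: there 1/(q;q)_1 cancels 1 - q exactly. -/
theorem offDiag_succ_sub_nonneg (j n m : ℕ) :
    NonnegCoeff (offDiag (j + 1) (n + 1) m - X ^ (n ^ 2) * bailey j n m) := by
  rw [offDiag_succ, Finset.sum_range_succ, Nat.add_sub_cancel_left]
  have h1 : (1 - X) * qInv 1 = 1 := by
    simpa [qInv_zero] using one_sub_mul_qInv 0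
  rw [h1, mul_one, ← add_assoc, add_sub_cancel_right]
  exact ((NonnegCoeff.X_pow _).mul (offDiag_nonneg _ _ _)).add
    (.sum fun i hi => one_sub_X_mul_qInv_mul_nonneg j m ((Finset.mem_range.1 hi).trans n.lt_succ_self))

theorem bailey_zero_two_sub_nonneg (m : ℕ) : NonnegCoeff (bailey 0 2 m - X ^ m * geo 2) := by
  have := (symmRecurrence_bailey one_pos).sub_nonneg two_pos (fun m => bailey_nonneg 0 1 m) m
  simpa [bailey_one] using this

theorem bailey_succ_two_sub_nonneg (j m : ℕ) :
    NonnegCoeff (bailey (j + 1) 2 m - X ^ (j + 1 + m) * geo 1) := by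
  rw [bailey_succ, Finset.sum_range_succ, Finset.sum_range_succ, Finset.sum_range_one, bailey_zero,
    bailey_one]
  have h := ((NonnegCoeff.X_pow (j + 3 + m)).mul ((geo_nonneg 1).mul (geo_nonneg 2))).add
    (((NonnegCoeff.X_pow (2 ^ 2)).mul (qInv_nonneg (2 - 2))).mul (bailey_nonneg j 2 m))
  convert h using 1
  have h1 : qInv (2 - 1) = geo 1 := by simp [qInv]
  rw [h1]
  linear_combination X ^ (j + 1 + m) * geo 1 * geo_eq two_pos

/-! ### Passage to the infinite product and series -/

theorem X_pow_dvd_qPoch_sub {n N : ℕ} (h : n ≤ N) : (X : PowerSeries ℤ) ^ (n + 1) ∣ qPoch N - qPoch n := by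
  induction N, h using Nat.le_induction with
  | base => simp
  | succ N hN ih =>
    have : qPoch (N + 1) - qPoch n = qPoch N - qPoch n - X ^ (N + 1) * qPoch N := by
      rw [qPoch, Finset.prod_range_succ, ← qPoch]; ring
    rw [this]
    exact dvd_sub ih ((pow_dvd_pow X (by omega)).mul_right _)

theorem X_pow_dvd_eulerProduct_sub (n : ℕ) :
    (X : PowerSeries ℤ) ^ (n + 1) ∣ eulerProduct - qPoch n := by
  rw [X_pow_dvd_iff]
  intro d hd
  rw [map_sub, sub_eq_zero]
  have h := ((WithPiTopology.continuous_coeff ℤ d).tendsto _).comp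
    multipliable_eulerProduct.hasProd.tendsto_prod_nat
  refine tendsto_nhds_unique h (tendsto_const_nhds.congr' ?_)
  filter_upwards [Filter.eventually_ge_atTop n] with N hN
  have := X_pow_dvd_iff.1 (X_pow_dvd_qPoch_sub hN) d hd
  rw [map_sub, sub_eq_zero] at this
  exact this.symm

theorem X_pow_dvd_inv_sub {a n : ℕ} (h : a ≤ n + 1) :
    (X : PowerSeries ℤ) ^ a ∣ qInv n - invOfUnit eulerProduct 1 := by
  have : qInv n - invOfUnit eulerProduct 1 =
      (eulerProduct - qPoch n) * (qInv n * invOfUnit eulerProduct 1) := by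
    linear_combination (-(qInv n)) * eulerProduct_mul_inv +
      invOfUnit eulerProduct 1 * qPoch_mul_qInv n
  rw [this]
  exact ((pow_dvd_pow X h).trans (X_pow_dvd_eulerProduct_sub n)).mul_right _

theorem rankTerm_eq (k : ℕ) (m : ℤ) (t : ℕ) :
    rankTerm (k + 1) m (t + 1) = baileyTerm k m.natAbs t := by
  rw [rankTerm, baileyTerm]
  have h : (t + 1) * ((2 * (k + 1) - 1) * (t + 1) - 1) / 2 = k * (t + 1) ^ 2 + (t + 1).choose 2 := by
    rw [Nat.choose_two_right, show 2 * (k + 1) - 1 = 2 * k + 1 by omega]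
    have : (t + 1) * ((2 * k + 1) * (t + 1) - 1) = 2 * (k * (t + 1) ^ 2) + (t + 1) * (t + 1 - 1) := by
      rw [show (2 * k + 1) * (t + 1) - 1 = 2 * k * (t + 1) + t by
        rw [add_mul, one_mul]; omega, Nat.add_sub_cancel]
      ring
    rw [this, Nat.mul_add_div two_pos]
  rw [h, Nat.add_sub_cancel]

theorem X_pow_dvd_rankSeries_sub {k : ℕ} (hk : 1 ≤ k) (m : ℤ) {a n : ℕ}
    (h : a ≤ k * (n + 1) ^ 2 + (n + 1).choose 2 + m.natAbs * (n + 1)) :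
    (X : PowerSeries ℤ) ^ a ∣
      rankSeries (k + 1) m - ∑ t ∈ Finset.range n, baileyTerm k m.natAbs t := by
  rw [X_pow_dvd_iff]
  intro d hd
  rw [map_sub, sub_eq_zero, map_sum]
  have h1 := (summable_rankTerm (k + 1) (by omega) m).hasSum.map (coeff (R := ℤ) d)
    (WithPiTopology.continuous_coeff ℤ d)
  refine h1.unique ?_
  simp only [rankTerm_eq]
  refine hasSum_sum_of_ne_finset_zero fun t ht => ?_
  rw [Finset.mem_range, not_lt] at ht
  have ht' : n + 1 ≤ t + 1 := by omega
  have hle : d < k * (t + 1) ^ 2 + (t + 1).choose 2 + m.natAbs * (t + 1) := by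
    refine hd.trans_le (h.trans ?_)
    have := Nat.choose_le_choose 2 ht'
    gcongr
  have : (X : PowerSeries ℤ) ^ (k * (t + 1) ^ 2 + (t + 1).choose 2 + m.natAbs * (t + 1)) ∣
      baileyTerm k m.natAbs t := (Dvd.intro_left _ rfl).mul_right _
  exact X_pow_dvd_iff.1 this d hle

theorem X_pow_dvd_bailey_sub {k : ℕ} (hk : 1 ≤ k) (m : ℤ) (n : ℕ) :
    (X : PowerSeries ℤ) ^ (n + 1) ∣ bailey k n m.natAbs -
      invOfUnit eulerProduct 1 * (invOfUnit eulerProduct 1 * rankSeries (k + 1) m) := by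
  set I := invOfUnit eulerProduct 1
  have h1 : (X : PowerSeries ℤ) ^ (n + 1) ∣ bailey k n m.natAbs -
      ∑ t ∈ Finset.range n, I * (I * baileyTerm k m.natAbs t) := by
    rw [bailey, ← Finset.sum_sub_distrib]
    refine Finset.dvd_sum fun t ht => ?_
    obtain ⟨d, rfl⟩ := Nat.exists_eq_add_of_lt (Finset.mem_range.1 ht)
    rw [show t + d + 1 - (t + 1) = d by omega]
    -- `qInv d` is accurate only below q^(d+1); the missing t + 1 orders come from `baileyTerm`,
    -- because k ≥ 1.
    have ha : (X : PowerSeries ℤ) ^ (t + d + 1 + 1) ∣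
        baileyTerm k m.natAbs t * (qInv d - I) := by
      have hb : (X : PowerSeries ℤ) ^ (t + 1) ∣ baileyTerm k m.natAbs t := by
        refine ((pow_dvd_pow X ?_).mul_left _).mul_right _
        nlinarith [Nat.zero_le ((t + 1).choose 2), Nat.zero_le (m.natAbs * (t + 1)),
          Nat.mul_le_mul_right ((t + 1) ^ 2) hk]
      have := mul_dvd_mul hb (X_pow_dvd_inv_sub (le_refl (d + 1)))
      rwa [← pow_add, show t + 1 + (d + 1) = t + d + 1 + 1 by ring] at this
    have hb : (X : PowerSeries ℤ) ^ (t + d + 1 + 1) ∣ qInv (t + d + 1 + (t + 1)) - I :=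
      X_pow_dvd_inv_sub (by omega)
    convert dvd_add (ha.mul_right (qInv (t + d + 1 + (t + 1))))
      (hb.mul_left (I * baileyTerm k m.natAbs t)) using 1
    ring
  have h2 : (X : PowerSeries ℤ) ^ (n + 1) ∣
      rankSeries (k + 1) m - ∑ t ∈ Finset.range n, baileyTerm k m.natAbs t := by
    refine X_pow_dvd_rankSeries_sub hk m ?_
    nlinarith [Nat.zero_le ((n + 1).choose 2), Nat.zero_le (m.natAbs * (n + 1)),
          Nat.mul_le_mul_right ((n + 1) ^ 2) hk]
  convert dvd_sub h1 (h2.mul_left (I * I)) using 1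
  simp only [← Finset.mul_sum]
  ring

/-- The expansion of the generating function over successive Durfee squares, up to order `n`. -/
theorem X_pow_dvd_rankGenFun_sub (k : ℕ) (m : ℤ) (n : ℕ) :
    (X : PowerSeries ℤ) ^ (n + 1) ∣ rankGenFun (k + 2) m -
      ∑ i ∈ Finset.range (n + 1), X ^ (i ^ 2) * bailey k i m.natAbs := by
  have h1 := X_pow_dvd_bailey_sub (Nat.le_add_left 1 k) m n
  have h2 : (X : PowerSeries ℤ) ^ (n + 1) ∣ bailey (k + 1) n m.natAbs - ∑ i ∈ Finset.range (n + 1),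
      invOfUnit eulerProduct 1 * (X ^ (i ^ 2) * bailey k i m.natAbs) := by
    rw [bailey_succ, ← Finset.sum_sub_distrib]
    refine Finset.dvd_sum fun i hi => ?_
    obtain ⟨d, rfl⟩ := Nat.exists_eq_add_of_le (Nat.lt_succ_iff.1 (Finset.mem_range.1 hi))
    rw [Nat.add_sub_cancel_left]
    have hi : i ≤ i ^ 2 := Nat.le_self_pow two_ne_zero i
    have := mul_dvd_mul (pow_dvd_pow (X : PowerSeries ℤ) hi) (X_pow_dvd_inv_sub (le_refl (d + 1)))
    rw [← pow_add, ← add_assoc] at this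
    convert this.mul_right (bailey k i m.natAbs) using 1
    ring
  have h3 := (dvd_sub h2 h1).mul_left eulerProduct
  rw [← Finset.mul_sum] at h3
  rw [rankGenFun]
  convert h3 using 1
  linear_combination (-(invOfUnit eulerProduct 1 * rankSeries (k + 2) m) +
    ∑ i ∈ Finset.range (n + 1), X ^ (i ^ 2) * bailey k i m.natAbs) * eulerProduct_mul_inv

/-! ### Lower bounds for the differences -/

theorem N_succ_sub (k : ℕ) (m : ℤ) (n : ℕ) :
    N k m (n + 1) - N k m n = coeff (n + 1) ((1 - X) * rankGenFun k m) := by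
  rw [sub_mul, one_mul, map_sub, coeff_succ_X_mul, N, N]

/-- The chains 2, 1, ... give q^(4+1+k+m) `geo 2`, which reduces q^(k+2+m)(1 - q) `geo 2` to
q^(k+2+m)(`geo 2` - q). The chains 3, 2, ... give the term with 13 = 9 + 4. -/
theorem one_sub_X_mul_sum_sub_nonneg (k m L : ℕ) :
    NonnegCoeff ((1 - X) * ∑ i ∈ Finset.range (L + 4), X ^ (i ^ 2) * bailey (k + 1) i m -
      (X ^ (k + 2 + m) * (geo 2 - X) + X ^ 13 * bailey k 2 m +
        ∑ i ∈ Finset.range (L + 2), X ^ ((k + 2) * (i + 2) ^ 2) * ((1 - X) * bailey 0 (i + 2) m))) := by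
  have hsum : (1 - X) * ∑ i ∈ Finset.range (L + 4), X ^ (i ^ 2) * bailey (k + 1) i m =
      ∑ i ∈ Finset.range (L + 2), X ^ ((k + 2) * (i + 2) ^ 2) * ((1 - X) * bailey 0 (i + 2) m) +
      ∑ i ∈ Finset.range (L + 2), X ^ ((i + 2) ^ 2) * offDiag (k + 1) (i + 2) m +
        X ^ (k + 2 + m) * (1 - X) * geo 2 := by
    have : ∀ i, (1 - X) * (X ^ ((i + 1 + 1) ^ 2) * bailey (k + 1) (i + 1 + 1) m) =
        X ^ ((k + 2) * (i + 2) ^ 2) * ((1 - X) * bailey 0 (i + 2) m) +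
          X ^ ((i + 2) ^ 2) * offDiag (k + 1) (i + 2) m := fun i => by
      rw [offDiag]; ring
    rw [Finset.sum_range_succ', Finset.sum_range_succ', bailey_zero, zero_add, bailey_one, mul_add,
      mul_add, Finset.mul_sum]
    simp only [this, Finset.sum_add_distrib]
    ring
  have h2 := (NonnegCoeff.X_pow 4).mul (offDiag_succ_sub_nonneg k 1 m)
  have h3 := (NonnegCoeff.X_pow 9).mul (offDiag_succ_sub_nonneg k 2 m)
  have h4 : NonnegCoeff
      (∑ i ∈ Finset.range L, X ^ ((i + 1 + 1 + 2) ^ 2) * offDiag (k + 1) (i + 1 + 1 + 2) m) :=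
    .sum fun i _ => (NonnegCoeff.X_pow _).mul (offDiag_nonneg _ _ _)
  have hoff : ∑ i ∈ Finset.range (L + 2), X ^ ((i + 2) ^ 2) * offDiag (k + 1) (i + 2) m =
      ∑ i ∈ Finset.range L, X ^ ((i + 1 + 1 + 2) ^ 2) * offDiag (k + 1) (i + 1 + 1 + 2) m +
        X ^ 9 * offDiag (k + 1) (2 + 1) m + X ^ 4 * offDiag (k + 1) (1 + 1) m := by
    rw [Finset.sum_range_succ', Finset.sum_range_succ']
    rfl
  rw [hsum, hoff]
  convert (h2.add h3).add h4 using 1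
  rw [bailey_one]
  linear_combination (-(X ^ (k + 3 + m))) * one_sub_mul_geo two_pos

theorem coeff_one_sub_X_mul_rankGenFun (k : ℕ) (m : ℤ) (e : ℕ) :
    coeff e ((1 - X) * rankGenFun (k + 3) m) = coeff e ((1 - X) *
      ∑ i ∈ Finset.range (e + 4), X ^ (i ^ 2) * bailey (k + 1) i m.natAbs) := by
  have h := (X_pow_dvd_rankGenFun_sub (k + 1) m (e + 3)).mul_left (1 - X)
  have := X_pow_dvd_iff.1 h e (by omega)
  rwa [mul_sub, map_sub, sub_eq_zero] at this

theorem le_coeff_one_sub_X_mul_rankGenFun (k : ℕ) (m : ℤ) (e : ℕ) :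
    coeff e (X ^ (k + 2 + m.natAbs) * (geo 2 - X)) + coeff e (X ^ 13 * bailey k 2 m.natAbs) +
      ∑ i ∈ Finset.range (e + 2),
        coeff e (X ^ ((k + 2) * (i + 2) ^ 2) * ((1 - X) * bailey 0 (i + 2) m.natAbs)) ≤
      coeff e ((1 - X) * rankGenFun (k + 3) m) := by
  rw [coeff_one_sub_X_mul_rankGenFun, ← sub_nonneg]
  have := one_sub_X_mul_sum_sub_nonneg k m.natAbs e e
  rwa [map_sub, map_add, map_add, map_sum] at this

theorem coeff_X_pow_mul_geo_two_sub (a e : ℕ) : coeff e (X ^ a * (geo 2 - X)) =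
    if a ≤ e then (if 2 ∣ e - a then 1 else 0) - (if e - a = 1 then 1 else 0) else 0 := by
  rw [coeff_X_pow_mul', map_sub, coeff_geo, coeff_X]

theorem coeff_rankGenFun_nonneg_of_ne_zero (k : ℕ) {m : ℤ} (hm : m ≠ 0) {e : ℕ}
    (he : e ≠ k + 3 + m.natAbs) : 0 ≤ coeff e ((1 - X) * rankGenFun (k + 3) m) := by
  refine le_trans ?_ (le_coeff_one_sub_X_mul_rankGenFun k m e)
  have h1 : 0 ≤ coeff e (X ^ (k + 2 + m.natAbs) * (geo 2 - X)) := by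
    rw [coeff_X_pow_mul_geo_two_sub]
    split_ifs <;> omega
  have h2 := (NonnegCoeff.X_pow 13).mul (bailey_nonneg k 2 m.natAbs) e
  refine add_nonneg (add_nonneg h1 h2) (Finset.sum_nonneg fun i _ => ?_)
  obtain ⟨M, hM⟩ := Nat.exists_eq_succ_of_ne_zero (Int.natAbs_ne_zero.2 hm)
  rw [hM]
  exact (NonnegCoeff.X_pow _).mul ((almostNonneg_bailey (Nat.le_add_left 2 i)).succ M) e

theorem neg_le_coeff_diag (k i e : ℕ) :
    -(if e = (k + 2) * (i + 2) ^ 2 + 1 then 1 else 0 : ℤ) ≤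
      coeff e (X ^ ((k + 2) * (i + 2) ^ 2) * ((1 - X) * bailey 0 (i + 2) 0)) := by
  have h := (NonnegCoeff.X_pow ((k + 2) * (i + 2) ^ 2)).mul
    (almostNonneg_bailey (Nat.le_add_left 2 i)).zero e
  rw [mul_add, ← pow_succ, map_add, coeff_X_pow] at h
  linarith

theorem one_le_coeff_compensation (k i : ℕ) (h : ¬ (k = 0 ∧ i = 0)) :
    1 ≤ coeff ((k + 2) * (i + 2) ^ 2 + 1) (X ^ (k + 2 + 0) * (geo 2 - X)) +
      coeff ((k + 2) * (i + 2) ^ 2 + 1) (X ^ 13 * bailey k 2 0) := by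
  have hlow : 4 * (k + 2) + i * (k + 2) * 4 ≤ (k + 2) * (i + 2) ^ 2 := by
    have : (k + 2) * (i + 2) ^ 2 = 4 * (k + 2) + i * (k + 2) * 4 + (k + 2) * i ^ 2 := by ring
    omega
  have hik : 2 * i ≤ i * (k + 2) := by rw [mul_comm 2]; exact Nat.mul_le_mul_left _ (by omega)
  have h2 := (NonnegCoeff.X_pow 13).mul (bailey_nonneg k 2 0) ((k + 2) * (i + 2) ^ 2 + 1)
  have h1 : 0 ≤ coeff ((k + 2) * (i + 2) ^ 2 + 1) (X ^ (k + 2 + 0) * (geo 2 - X)) := by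
    rw [coeff_X_pow_mul_geo_two_sub]
    split_ifs <;> omega
  -- For k = 0 the target exponent and 13 are both odd, so `geo 2` suffices. For positive k the
  -- bound by `geo 1` reaches every exponent from 13 + k on; only k = 1, i = 0 (exponent 13) falls
  -- short, and there q³ `geo 2` contributes.
  rcases k with _ | k
  · have h3 := (NonnegCoeff.X_pow 13).mul (bailey_zero_two_sub_nonneg 0) ((0 + 2) * (i + 2) ^ 2 + 1)
    have h4 : coeff ((0 + 2) * (i + 2) ^ 2 + 1) (X ^ 13 * (X ^ 0 * geo 2)) = 1 := by
      rw [pow_zero, one_mul, coeff_X_pow_mul', coeff_geo, if_pos (by omega), if_pos (by omega)]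
    rw [mul_sub, map_sub, h4] at h3
    omega
  · by_cases hc : k = 0 ∧ i = 0
    · obtain ⟨rfl, rfl⟩ := hc
      rw [coeff_X_pow_mul_geo_two_sub] at h1 ⊢
      norm_num at *
      exact h2
    · have h3 := (NonnegCoeff.X_pow 13).mul (bailey_succ_two_sub_nonneg k 0)
        ((k + 1 + 2) * (i + 2) ^ 2 + 1)
      have h4 : coeff ((k + 1 + 2) * (i + 2) ^ 2 + 1) (X ^ 13 * (X ^ (k + 1 + 0) * geo 1)) = 1 := by
        rw [← mul_assoc, ← pow_add, coeff_X_pow_mul', coeff_geo, if_pos (by omega),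
          if_pos (one_dvd _)]
      rw [mul_sub, map_sub, h4] at h3
      omega

theorem coeff_rankGenFun_nonneg_of_eq_zero (k : ℕ) {e : ℕ} (he : e ≠ k + 3)
    (he' : ¬ (k = 0 ∧ e = 9)) : 0 ≤ coeff e ((1 - X) * rankGenFun (k + 3) 0) := by
  refine le_trans ?_ (le_coeff_one_sub_X_mul_rankGenFun k 0 e)
  rw [Int.natAbs_zero]
  have h3 := Finset.sum_le_sum fun i (_ : i ∈ Finset.range (e + 2)) => neg_le_coeff_diag k i e
  rw [Finset.sum_neg_distrib] at h3
  by_cases hi : ∃ i, e = (k + 2) * (i + 2) ^ 2 + 1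
  · obtain ⟨i, hi⟩ := hi
    -- The exponents (k+2)(j+2)² + 1 are distinct, so at most one defect falls on e.
    have h4 : ∑ j ∈ Finset.range (e + 2), (if e = (k + 2) * (j + 2) ^ 2 + 1 then 1 else 0 : ℤ) ≤ 1 := by
      have : ∀ j, e = (k + 2) * (j + 2) ^ 2 + 1 ↔ i = j := by
        intro j
        rw [hi]
        constructor
        · intro h
          have := Nat.pow_left_injective two_ne_zero
            (Nat.eq_of_mul_eq_mul_left (by omega) (Nat.add_right_cancel h))
          simpa using this
        · rintro rfl; rfl
      simp only [this, Finset.sum_ite_eq]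
      split_ifs <;> norm_num
    have h5 := one_le_coeff_compensation k i (by rintro ⟨rfl, rfl⟩; exact he' ⟨rfl, by simpa using hi⟩)
    rw [← hi] at h5
    linarith
  · have h4 : ∑ j ∈ Finset.range (e + 2), (if e = (k + 2) * (j + 2) ^ 2 + 1 then 1 else 0 : ℤ) = 0 :=
      Finset.sum_eq_zero fun j _ => if_neg fun h => hi ⟨j, h⟩
    have h1 : 0 ≤ coeff e (X ^ (k + 2 + 0) * (geo 2 - X)) := by
      rw [coeff_X_pow_mul_geo_two_sub]
      split_ifs <;> omega
    have h2 := (NonnegCoeff.X_pow 13).mul (bailey_nonneg k 2 0) e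
    linarith

/-! ### The exceptional coefficients -/

/-- To this order only the first term of the series counts, and 1/(q;q)_∞ agrees with 1/(1 - q)
modulo q². -/
theorem coeff_rankGenFun_leading (k : ℕ) (m : ℤ) :
    coeff (k + 3 + m.natAbs) ((1 - X) * rankGenFun (k + 3) m) = -1 := by
  have h1 : (X : PowerSeries ℤ) ^ (k + 4 + m.natAbs) ∣ rankSeries (k + 3) m -
      ∑ t ∈ Finset.range 1, baileyTerm (k + 2) m.natAbs t :=
    X_pow_dvd_rankSeries_sub (by omega) m (by omega)
  have h3 : (X : PowerSeries ℤ) ^ (k + 4 + m.natAbs) ∣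
      X ^ (k + 2 + m.natAbs) * ((1 - X) * (1 - X)) * (qInv 1 - invOfUnit eulerProduct 1) := by
    have := mul_dvd_mul (dvd_refl ((X : PowerSeries ℤ) ^ (k + 2 + m.natAbs)))
      ((X_pow_dvd_inv_sub (le_refl 2)).mul_left ((1 - X) * (1 - X)))
    rw [← pow_add] at this
    convert this using 1 <;> ring
  have h4 := dvd_sub (h1.mul_left ((1 - X) * invOfUnit eulerProduct 1)) h3
  have h5 : (1 - X) * qInv 1 = 1 := by
    simpa [qInv_zero] using one_sub_mul_qInv 0
  have h6 : (X : PowerSeries ℤ) ^ (k + 4 + m.natAbs) ∣ (1 - X) * rankGenFun (k + 3) m -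
      (X ^ (k + 2 + m.natAbs) - X ^ (k + 3 + m.natAbs)) := by
    convert h4 using 1
    rw [Finset.sum_range_one, baileyTerm, rankGenFun]
    simp only [zero_add, one_pow, Nat.choose_succ_self, mul_one, pow_zero,
      one_mul, pow_one, add_zero]
    linear_combination X ^ (k + 2 + m.natAbs) * (1 - X) * h5
  have h7 := X_pow_dvd_iff.1 h6 (k + 3 + m.natAbs) (by omega)
  rw [map_sub, sub_eq_zero] at h7
  rw [h7, map_sub, coeff_X_pow, coeff_X_pow, if_neg (by omega), if_pos rfl, zero_sub]

theorem coeff_rankGenFun_three_zero : coeff 9 ((1 - X) * rankGenFun 3 0) = -1 := by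
  have h1 : (X : PowerSeries ℤ) ^ 10 ∣ rankSeries 3 0 -
      ∑ t ∈ Finset.range 2, baileyTerm 2 (0 : ℤ).natAbs t :=
    X_pow_dvd_rankSeries_sub (k := 2) (by omega) 0 (by decide)
  have h2 : (X : PowerSeries ℤ) ^ 8 ∣ qInv 7 - invOfUnit eulerProduct 1 := X_pow_dvd_inv_sub le_rfl
  have h3 : (X : PowerSeries ℤ) ^ 1 ∣ qInv 0 - invOfUnit eulerProduct 1 := X_pow_dvd_inv_sub le_rfl
  have h4 : (X : PowerSeries ℤ) ^ 8 ∣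
      (1 - X) ^ 2 * qInv 7 - (1 - X + X ^ 2 + X ^ 4 + 2 * X ^ 6) := by
    -- The polynomial is ((1 - q)² - P (q;q)_7)/q^8, where P = 1 - q + q² + q⁴ + 2q⁶.
    refine Dvd.intro (qInv 7 * (2 - X - 3 * X ^ 3 + X ^ 4 - 3 * X ^ 5 + X ^ 6 +
      X ^ 7 + 2 * X ^ 8 + 3 * X ^ 9 + 2 * X ^ 10 - 2 * X ^ 12 - X ^ 13 - 5 * X ^ 14 - 2 * X ^ 16 +
      2 * X ^ 17 + X ^ 18 + 3 * X ^ 19 + X ^ 20 - X ^ 23 - X ^ 24 - 2 * X ^ 25 + 2 * X ^ 26)) ?_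
    have h := qPoch_mul_qInv 7
    have hq : qPoch 7 = (1 - X) * (1 - X ^ 2) * (1 - X ^ 3) * (1 - X ^ 4) * (1 - X ^ 5) *
        (1 - X ^ 6) * (1 - X ^ 7) := by
      simp [qPoch, Finset.prod_range_succ]
    rw [hq] at h
    linear_combination (-(1 - X + X ^ 2 + X ^ 4 + 2 * X ^ 6)) * h
  obtain ⟨a, ha⟩ := h1
  obtain ⟨b, hb⟩ := h2
  obtain ⟨c, hc⟩ := h3
  obtain ⟨d, hd⟩ := h4
  have h5 : (X : PowerSeries ℤ) ^ 10 ∣ (1 - X) * rankGenFun 3 0 -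
      (X ^ 2 - X ^ 3 + X ^ 4 + X ^ 6 + 2 * X ^ 8 - X ^ 9) := by
    set I := invOfUnit eulerProduct 1
    -- The last summand comes from (1 - q)(1 - q²) = 1 - q(1 + q - q²) in the second series term,
    -- which starts at -q⁹.
    refine Dvd.intro ((1 - X) * I * a + d - (1 - X) ^ 2 * b + c + (1 + X - X ^ 2) * I) ?_
    rw [rankGenFun]
    simp only [Finset.sum_range_succ, Finset.sum_range_zero, baileyTerm, Int.natAbs_zero] at ha
    rw [qInv_zero] at hc
    norm_num [Nat.choose] at ha
    linear_combination (-((1 - X) * I)) * ha - X ^ 2 * hd + X ^ 2 * (1 - X) ^ 2 * hb - X ^ 9 * hc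
  have h6 := X_pow_dvd_iff.1 h5 9 (by omega)
  rw [map_sub, sub_eq_zero] at h6
  rw [h6, two_mul]
  simp [coeff_X_pow]

end

end GarvanRank

theorem theorem1p6 (k : ℕ) (hk : 3 ≤ k) (n : ℕ) (hn : k - 1 ≤ n) (m : ℤ) :
    GarvanRank.N k m (n + 1) ≥ GarvanRank.N k m n ↔
      ¬ (n = m.natAbs + k - 1 ∨ (k = 3 ∧ m = 0 ∧ n = 8)) := by
  obtain ⟨k, rfl⟩ := Nat.exists_eq_add_of_le' hk
  rw [ge_iff_le, ← sub_nonneg, GarvanRank.N_succ_sub]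
  constructor
  · rintro h (rfl | ⟨h3, rfl, rfl⟩)
    · rw [show m.natAbs + (k + 3) - 1 + 1 = k + 3 + m.natAbs by omega,
        GarvanRank.coeff_rankGenFun_leading] at h
      omega
    · rw [h3, GarvanRank.coeff_rankGenFun_three_zero] at h
      omega
  · intro h
    rcases eq_or_ne m 0 with rfl | hm
    · exact GarvanRank.coeff_rankGenFun_nonneg_of_eq_zero k (by omega) (by omega)
    · exact GarvanRank.coeff_rankGenFun_nonneg_of_ne_zero k hm (by omega)
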